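/- **Theorem 4.12 (main theorem).** All graphs are finite, simple and labeled, and two labeled graphs are identical when they have the same vertex set and the same edge set. For a graph $G$ and a vertex $x$, let $N(x)$ be the set of neighbours of $x$, and let $T_3(G)$ be the set of $3$-element subsets of $V(G)$ that induce a connected subgraph of $G$ (the connected triples of $G$). A connected graph $G$ is *strongly $T_3$-reconstructible* if every connected labeled graph $H$ with $T_3(H)=T_3(G)$ is identical to $G$. Consider the following six families of graphs, each with a highlighted edge $uv$. In each family the vertices listed are pairwise distinct, each pair listed under "edges" is an edge, each pair listed under "optional" may or may not be an edge (independently of each other), and every other pair is a non-edge. - $\mathcal F_1$: vertices $u,v,a,b$; edges $uv,ua,vb$; optional $ub$. - $\mathcal F_2$: vertices $u,v,a,b$; edges $uv,va,vb$; optional $ab$. - $\mathcal F_3$: vertices $u,v,a,b,c$; edges $uv,ub,vc,bc,ab$; optional $uc$. - $\mathcal F_4$: vertices $u,v,a,b,c$; edges $uv,va,ab,ac$; optional $bc$. - $\mathcal F_5$: vertices $u,v,a,b,c$; edges $uv,uc,bc,ab$; optional $ua,va$. - $\mathcal F_6$: vertices $u,v,a,b,c$; edges $uv,ua,vc,ac,ab$;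 optional $bc$. Let $G$ be a connected graph on $n\ge 5$ vertices. Then $G$ is strongly $T_3$-reconstructible if and only if the following two conditions hold: 1. $N(v_1)\setminus\{v_2\}\neq N(v_2)\setminus\{v_1\}$ for all distinct vertices $v_1,v_2$ of $G$; 2. for every edge $e$ of $G$ that lies in a triangle of $G$, there is an induced subgraph of $G$ belonging to one of the families $\mathcal F_1,\dots,\mathcal F_6$ in which $e$ is the highlighted edge $uv$ (either endpoint of $e$ may play the role of $u$). -/

import Mathlib

/-- A simple graph whose vertices carry labels from `L`: a vertex set `G.verts ⊆ L` together with a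
symmetric irreflexive adjacency relation between elements of `G.verts` (a subgraph of the complete
graph on all labels). Equality of labeled graphs is equality of vertex sets and of adjacency
relations; it is not isomorphism. -/
abbrev LabeledGraph (L : Type*) : Type _ := (⊤ : SimpleGraph L).Subgraph

namespace LabeledGraph

variable {L : Type*}

/-- `T_k(G)`: the `k`-element sets of vertices that induce a connected subgraph of `G`. -/
def connectedSets (G : LabeledGraph L) (k : ℕ) : Set (Finset L) :=
  {X | (X : Set L) ⊆ G.verts ∧ X.card = k ∧ (SimpleGraph.Subgraph.induce G (X : Set L)).Connected}

/-- `T_3(G)`: the connected triples of `G`. -/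
def connectedTriples (G : LabeledGraph L) : Set (Finset L) := connectedSets G 3

/-- `G` is identical to every finite connected labeled graph with the same connected triples.
The vertex set of `H` is not assumed to be the one of `G`. -/
def StronglyT3Reconstructible (G : LabeledGraph L) : Prop :=
  ∀ H : LabeledGraph L, H.verts.Finite → H.Connected →
    connectedTriples H = connectedTriples G → H = G

/-! In the following six predicates `u v` is the highlighted edge of an induced subgraph on the
listed vertices. Every pair of listed vertices is required to be an edge, required to be a non-edge,
or named in the description as optional. -/

/-- First family, on `u, v, a, b`. Edges: `uv, ua, vb`. Optional: `ub`. -/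
def IsF1 (G : LabeledGraph L) (u v a b : L) : Prop :=
  [u, v, a, b].Nodup ∧
  (G.Adj u v ∧ G.Adj u a ∧ G.Adj v b) ∧
  (¬ G.Adj v a ∧ ¬ G.Adj a b)

/-- Second family, on `u, v, a, b`. Edges: `uv, va, vb`. Optional: `ab`. -/
def IsF2 (G : LabeledGraph L) (u v a b : L) : Prop :=
  [u, v, a, b].Nodup ∧
  (G.Adj u v ∧ G.Adj v a ∧ G.Adj v b) ∧
  (¬ G.Adj u a ∧ ¬ G.Adj u b)

/-- Third family, on `u, v, a, b, c`. Edges: `uv, ub, vc, bc, ab`. Optional: `uc`. -/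
def IsF3 (G : LabeledGraph L) (u v a b c : L) : Prop :=
  [u, v, a, b, c].Nodup ∧
  (G.Adj u v ∧ G.Adj u b ∧ G.Adj v c ∧ G.Adj b c ∧ G.Adj a b) ∧
  (¬ G.Adj u a ∧ ¬ G.Adj v a ∧ ¬ G.Adj v b ∧ ¬ G.Adj a c)

/-- Fourth family, on `u, v, a, b, c`. Edges: `uv, va, ab, ac`. Optional: `bc`. -/
def IsF4 (G : LabeledGraph L) (u v a b c : L) : Prop :=
  [u, v, a, b, c].Nodup ∧
  (G.Adj u v ∧ G.Adj v a ∧ G.Adj a b ∧ G.Adj a c) ∧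
  (¬ G.Adj u a ∧ ¬ G.Adj u b ∧ ¬ G.Adj u c ∧ ¬ G.Adj v b ∧ ¬ G.Adj v c)

/-- Fifth family, on `u, v, a, b, c`. Edges: `uv, uc, bc, ab`. Optional: `ua, va`. -/
def IsF5 (G : LabeledGraph L) (u v a b c : L) : Prop :=
  [u, v, a, b, c].Nodup ∧
  (G.Adj u v ∧ G.Adj u c ∧ G.Adj b c ∧ G.Adj a b) ∧
  (¬ G.Adj u b ∧ ¬ G.Adj v b ∧ ¬ G.Adj v c ∧ ¬ G.Adj a c)

/-- Sixth family, on `u, v, a, b, c`. Edges: `uv, ua, vc, ac, ab`. Optional: `bc`. -/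
def IsF6 (G : LabeledGraph L) (u v a b c : L) : Prop :=
  [u, v, a, b, c].Nodup ∧
  (G.Adj u v ∧ G.Adj u a ∧ G.Adj v c ∧ G.Adj a c ∧ G.Adj a b) ∧
  (¬ G.Adj u b ∧ ¬ G.Adj u c ∧ ¬ G.Adj v a ∧ ¬ G.Adj v b)

/-- Some induced subgraph of `G` belongs to one of the six families, with `u` and `v` in the two
places of the highlighted edge, in this order. -/
def InFamilyOriented (G : LabeledGraph L) (u v : L) : Prop :=
  (∃ a b, IsF1 G u v a b) ∨ (∃ a b, IsF2 G u v a b) ∨ (∃ a b c, IsF3 G u v a b c) ∨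
  (∃ a b c, IsF4 G u v a b c) ∨ (∃ a b c, IsF5 G u v a b c) ∨ (∃ a b c, IsF6 G u v a b c)

/-- The edge `uv` is, in one of its two directions, the highlighted edge of an induced subgraph of
`G` that belongs to one of the six families. -/
def EdgeInFamily (G : LabeledGraph L) (u v : L) : Prop :=
  InFamilyOriented G u v ∨ InFamilyOriented G v u

/-- The pair `u, v` is an edge of `G` that lies in a triangle of `G`. -/
def EdgeInTriangle (G : LabeledGraph L) (u v : L) : Prop :=
  G.Adj u v ∧ ∃ w, G.Adj u w ∧ G.Adj v w

end LabeledGraph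

namespace LabeledGraph

variable {L : Type*}

/-! A triple is connected exactly when it carries at least two edges. Hence, if a graph H with the
triples of G misses an edge uv of G, every z with {u, v, z} connected in G is adjacent in H to both
u and v; in each family this collides with other triples (`EdgeInFamily.adj`). Edges in no triangle
also persist once n ≥ 5 (`adj_of_no_common_neighbor`). So conditions 1 and 2 make every edge of G an
edge of H, and the ends of an extra edge of H would be twins in G.

Conversely, switching the pair between two twins changes no triple, so G has no twins. An edge uv
then has an end, say u, with a neighbor a ≠ v not adjacent to v. If uv is in no family, there is an
induced path v u a x whose vertices share all their other neighbors; exchanging u and a keeps the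
triples but makes v and a adjacent (`StronglyT3Reconstructible.edgeInFamily_aux`). No triangle is
needed here. -/

/-- At least two of the three pairs from `p, q, r` are edges. -/
def TwoEdges (G : LabeledGraph L) (p q r : L) : Prop :=
  (G.Adj p q ∧ G.Adj q r) ∨ (G.Adj p q ∧ G.Adj p r) ∨ (G.Adj p r ∧ G.Adj q r)

/-- Two graphs with the same triples carrying at least two edges. -/
def SameTriples (G H : LabeledGraph L) : Prop :=
  ∀ p q r, p ≠ q → p ≠ r → q ≠ r → (TwoEdges G p q r ↔ TwoEdges H p q r)

/-! ### Connectedness through cuts; connected triples as triples with two edges -/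

/-- A connected graph has an edge leaving any vertex set that separates two of its vertices. -/
theorem exists_adj_boundary {G : LabeledGraph L} (hG : G.Connected) (S : Set L) {v z : L}
    (hv : v ∈ G.verts) (hz : z ∈ G.verts) (hvS : v ∈ S) (hzS : z ∉ S) :
    ∃ p ∈ S, ∃ q, q ∉ S ∧ G.Adj p q := by
  obtain ⟨w⟩ := hG.coe.preconnected ⟨v, hv⟩ ⟨z, hz⟩
  obtain ⟨d, -, h1, h2⟩ := w.exists_boundary_dart (Subtype.val ⁻¹' S) hvS hzS
  exact ⟨d.fst, h1, d.snd, h2, d.adj⟩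

theorem connected_of_adj_boundary {G : LabeledGraph L} {v : L} (hv : v ∈ G.verts)
    (h : ∀ S : Set L, v ∈ S → (∃ z ∈ G.verts, z ∉ S) → ∃ p ∈ S, ∃ q, q ∉ S ∧ G.Adj p q) :
    G.Connected := by
  refine SimpleGraph.Subgraph.connected_iff'.2
    ((SimpleGraph.connected_iff_exists_forall_reachable _).2 ⟨⟨v, hv⟩, fun ⟨z, hz⟩ => ?_⟩)
  by_contra hcon
  obtain ⟨p, ⟨hp, hpr⟩, q, hq, hpq⟩ := h {y | ∃ hy : y ∈ G.verts, G.coe.Reachable ⟨v, hv⟩ ⟨y, hy⟩}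
    ⟨hv, SimpleGraph.Reachable.refl _⟩ ⟨z, hz, fun ⟨_, h⟩ => hcon h⟩
  refine hq ⟨hpq.snd_mem, hpr.trans (SimpleGraph.Adj.reachable ?_)⟩
  exact hpq

theorem triple_mem_connectedTriples [DecidableEq L] (G : LabeledGraph L) {p q r : L}
    (hpq : p ≠ q) (hpr : p ≠ r) (hqr : q ≠ r) :
    ({p, q, r} : Finset L) ∈ connectedTriples G ↔ TwoEdges G p q r := by
  have hadj : ∀ x y, (SimpleGraph.Subgraph.induce G (({p, q, r} : Finset L) : Set L)).Adj x y ↔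
      (x = p ∨ x = q ∨ x = r) ∧ (y = p ∨ y = q ∨ y = r) ∧ G.Adj x y := by
    intro x y
    simp [SimpleGraph.Subgraph.induce_adj]
  constructor
  · rintro ⟨-, -, hc⟩
    have key : ∀ S : Set L, ∀ x y : L, (x = p ∨ x = q ∨ x = r) → (y = p ∨ y = q ∨ y = r) → x ∈ S →
        y ∉ S → ∃ s ∈ S, ∃ t, t ∉ S ∧ (s = p ∨ s = q ∨ s = r) ∧ (t = p ∨ t = q ∨ t = r) ∧
          G.Adj s t := by
      intro S x y hx hy hxS hyS
      obtain ⟨s, hs, t, ht, hst⟩ := exists_adj_boundary hc S (v := x) (z := y)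
        (by simpa using hx) (by simpa using hy) hxS hyS
      exact ⟨s, hs, t, ht, (hadj s t).1 hst⟩
    -- Cutting off each vertex in turn shows that none is isolated, and three vertices without an
    -- isolated one carry two edges.
    have h1 := key {p} p q (by simp) (by simp) (by simp) (by simp [hpq.symm])
    have h2 := key {q} q p (by simp) (by simp) (by simp) (by simp [hpq])
    have h3 := key {r} r p (by simp) (by simp) (by simp) (by simp [hpr])
    simp only [Set.mem_singleton_iff] at h1 h2 h3
    have c := @SimpleGraph.Subgraph.adj_comm _ _ G
    unfold TwoEdges
    obtain ⟨_, rfl, t1, ht1, -, h1, a1⟩ := h1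
    obtain ⟨_, rfl, t2, ht2, -, h2, a2⟩ := h2
    obtain ⟨_, rfl, t3, ht3, -, h3, a3⟩ := h3
    grind
  · intro h
    have c := @SimpleGraph.Subgraph.adj_comm _ _ G
    have hp : p ∈ G.verts ∧ q ∈ G.verts ∧ r ∈ G.verts := by
      rcases h with h | h | h <;>
        exact ⟨h.1.fst_mem,
          by first | exact h.1.fst_mem | exact h.1.snd_mem | exact h.2.fst_mem,
          h.2.snd_mem⟩
    refine ⟨?_, Finset.card_eq_three.2 ⟨p, q, r, hpq, hpr, hqr, rfl⟩, ?_⟩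
    · intro x hx
      simp only [Finset.coe_insert, Finset.coe_singleton, Set.mem_insert_iff,
        Set.mem_singleton_iff] at hx
      rcases hx with rfl | rfl | rfl
      exacts [hp.1, hp.2.1, hp.2.2]
    · refine connected_of_adj_boundary (v := p) (by simp) ?_
      rintro S hpS ⟨z, hz, hzS⟩
      simp only [SimpleGraph.Subgraph.induce_verts, Finset.coe_insert, Finset.coe_singleton,
        Set.mem_insert_iff, Set.mem_singleton_iff] at hz
      simp only [hadj]
      unfold TwoEdges at h
      by_cases hq : q ∈ S
      · have hr : r ∉ S := by grind
        by_cases h' : G.Adj p r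
        · exact ⟨p, hpS, r, hr, by simp, by simp, h'⟩
        · exact ⟨q, hq, r, hr, by simp, by simp, by tauto⟩
      · by_cases h' : G.Adj p q
        · exact ⟨p, hpS, q, hq, by simp, by simp, h'⟩
        · by_cases hr : r ∈ S
          · exact ⟨r, hr, q, hq, by simp, by simp, by grind⟩
          · exact ⟨p, hpS, r, hr, by simp, by simp, by tauto⟩

theorem connectedTriples_eq_iff (G H : LabeledGraph L) :
    connectedTriples H = connectedTriples G ↔ SameTriples G H := by
  classical
  constructor
  · intro h p q r h1 h2 h3
    rw [← triple_mem_connectedTriples G h1 h2 h3, ← triple_mem_connectedTriples H h1 h2 h3, h]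
  · intro h
    ext X
    by_cases hX : X.card = 3
    · obtain ⟨p, q, r, h1, h2, h3, rfl⟩ := Finset.card_eq_three.1 hX
      rw [triple_mem_connectedTriples G h1 h2 h3, triple_mem_connectedTriples H h1 h2 h3,
        h p q r h1 h2 h3]
    · exact ⟨fun hm => (hX hm.2.1).elim, fun hm => (hX hm.2.1).elim⟩

/-! ### Recovering the vertex set -/

theorem exists_notMem_of_card_lt {S : Set L} {l : List L} (h : l.length < S.ncard) :
    ∃ z ∈ S, z ∉ l := by
  classical
  by_contra! hcon
  have h1 : S.ncard ≤ (l.toFinset : Set L).ncard :=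
    Set.ncard_le_ncard (fun z hz => by simpa using hcon z hz) (Finset.finite_toSet _)
  rw [Set.ncard_coe_finset] at h1
  exact absurd (h1.trans (List.toFinset_card_le l)) (by omega)

/-- In a connected graph there is an edge leaving any short nonempty list of vertices. -/
theorem exists_adj_leaving {G : LabeledGraph L} (hG : G.Connected) {v : L} {l : List L}
    (hv : v ∈ G.verts) (hvl : v ∈ l) (h : l.length < G.verts.ncard) :
    ∃ p ∈ l, ∃ q, q ∉ l ∧ G.Adj p q := by
  obtain ⟨z, hz, hzl⟩ := exists_notMem_of_card_lt h
  exact exists_adj_boundary hG {x | x ∈ l} hv hz hvl hzl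

theorem exists_twoEdges_of_mem_verts {G : LabeledGraph L} (hG : G.Connected)
    (h : 3 ≤ G.verts.ncard) {v : L} (hv : v ∈ G.verts) :
    ∃ p q, v ≠ p ∧ v ≠ q ∧ p ≠ q ∧ TwoEdges G v p q := by
  obtain ⟨_, h1, p, hp, hvp⟩ := exists_adj_leaving hG (l := [v]) hv (by simp) (by simp; omega)
  obtain ⟨x, hx, q, hq, hxq⟩ := exists_adj_leaving hG (l := [v, p]) hv (by simp) (by simp; omega)
  simp only [List.mem_cons, List.not_mem_nil, or_false, not_or] at h1 hp hx hq
  subst h1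
  refine ⟨p, q, Ne.symm hp, Ne.symm hq.1, Ne.symm hq.2, ?_⟩
  rcases hx with rfl | rfl
  · exact Or.inr (Or.inl ⟨hvp, hxq⟩)
  · exact Or.inl ⟨hvp, hxq⟩

theorem TwoEdges.mem_verts {G : LabeledGraph L} {p q r : L} (h : TwoEdges G p q r) :
    p ∈ G.verts := by
  rcases h with h | h | h <;> exact h.1.fst_mem

theorem three_le_ncard_verts {G : LabeledGraph L} (hfin : G.verts.Finite) {X : Finset L}
    (hX : X ∈ connectedTriples G) : 3 ≤ G.verts.ncard := by
  rw [← hX.2.1, ← Set.ncard_coe_finset]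
  exact Set.ncard_le_ncard hX.1 hfin

/-- In a connected graph with at least three vertices, each vertex lies in a connected triple. For
`H` this size bound comes from a triple shared with `G`. -/
theorem verts_eq_of_connectedTriples_eq {G H : LabeledGraph L}
    (hHfin : H.verts.Finite) (hG : G.Connected) (hH : H.Connected) (hn : 3 ≤ G.verts.ncard)
    (h : connectedTriples H = connectedTriples G) : H.verts = G.verts := by
  classical
  have hT := (connectedTriples_eq_iff G H).1 h
  obtain ⟨v, hv⟩ := hG.nonempty
  obtain ⟨p, q, h1, h2, h3, h4⟩ := exists_twoEdges_of_mem_verts hG hn hv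
  have hn' : 3 ≤ H.verts.ncard :=
    three_le_ncard_verts hHfin (h ▸ (triple_mem_connectedTriples G h1 h2 h3).2 h4)
  ext x
  constructor
  · intro hx
    obtain ⟨p, q, h1, h2, h3, h4⟩ := exists_twoEdges_of_mem_verts hH hn' hx
    exact ((hT _ _ _ h1 h2 h3).2 h4).mem_verts
  · intro hx
    obtain ⟨p, q, h1, h2, h3, h4⟩ := exists_twoEdges_of_mem_verts hG hn hx
    exact ((hT _ _ _ h1 h2 h3).1 h4).mem_verts

/-! ### Edges forced by the six families -/

section Forcing

variable {G H : LabeledGraph L} {u v a b c : L}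

/-- Without `uv` in `H`, the triples `uva` and `uvb` put `va` and `vb` in `H`, and `vab` becomes
connected. -/
theorem IsF1.adj (h : IsF1 G u v a b) (hT : SameTriples G H) : H.Adj u v := by
  obtain ⟨hd, he, hne⟩ := h
  simp only [List.nodup_cons, List.mem_cons, List.not_mem_nil, or_false, not_or] at hd
  have cG := @SimpleGraph.Subgraph.adj_comm _ _ G
  have cH := @SimpleGraph.Subgraph.adj_comm _ _ H
  have h1 := hT u v a (by grind) (by grind) (by grind)
  have h2 := hT u v b (by grind) (by grind) (by grind)
  have h4 := hT v a b (by grind) (by grind) (by grind)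
  unfold TwoEdges at *
  grind

theorem IsF2.adj (h : IsF2 G u v a b) (hT : SameTriples G H) : H.Adj u v := by
  obtain ⟨hd, he, hne⟩ := h
  simp only [List.nodup_cons, List.mem_cons, List.not_mem_nil, or_false, not_or] at hd
  have cG := @SimpleGraph.Subgraph.adj_comm _ _ G
  have cH := @SimpleGraph.Subgraph.adj_comm _ _ H
  have h1 := hT u v a (by grind) (by grind) (by grind)
  have h2 := hT u v b (by grind) (by grind) (by grind)
  have h3 := hT u a b (by grind) (by grind) (by grind)
  unfold TwoEdges at *
  grind

/-- The five-vertex families need a chain of deductions, so all ten triples are supplied at once. -/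
theorem SameTriples.all_of_nodup (hT : SameTriples G H) (hd : [u, v, a, b, c].Nodup) :
    (TwoEdges G u v a ↔ TwoEdges H u v a) ∧ (TwoEdges G u v b ↔ TwoEdges H u v b) ∧
    (TwoEdges G u v c ↔ TwoEdges H u v c) ∧ (TwoEdges G u a b ↔ TwoEdges H u a b) ∧
    (TwoEdges G u a c ↔ TwoEdges H u a c) ∧ (TwoEdges G u b c ↔ TwoEdges H u b c) ∧
    (TwoEdges G v a b ↔ TwoEdges H v a b) ∧ (TwoEdges G v a c ↔ TwoEdges H v a c) ∧
    (TwoEdges G v b c ↔ TwoEdges H v b c) ∧ (TwoEdges G a b c ↔ TwoEdges H a b c) := by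
  simp only [List.nodup_cons, List.mem_cons, List.not_mem_nil, or_false, not_or] at hd
  refine ⟨?_, ?_, ?_, ?_, ?_, ?_, ?_, ?_, ?_, ?_⟩ <;> exact hT _ _ _ (by tauto) (by tauto) (by tauto)

theorem IsF3.adj (h : IsF3 G u v a b c) (hT : SameTriples G H) : H.Adj u v := by
  obtain ⟨hd, he, hne⟩ := h
  have key := hT.all_of_nodup hd
  have cG := @SimpleGraph.Subgraph.adj_comm _ _ G
  have cH := @SimpleGraph.Subgraph.adj_comm _ _ H
  unfold TwoEdges at *
  grind

theorem IsF4.adj (h : IsF4 G u v a b c) (hT : SameTriples G H) : H.Adj u v := by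
  obtain ⟨hd, he, hne⟩ := h
  have key := hT.all_of_nodup hd
  have cG := @SimpleGraph.Subgraph.adj_comm _ _ G
  have cH := @SimpleGraph.Subgraph.adj_comm _ _ H
  unfold TwoEdges at *
  grind

theorem IsF5.adj (h : IsF5 G u v a b c) (hT : SameTriples G H) : H.Adj u v := by
  obtain ⟨hd, he, hne⟩ := h
  have key := hT.all_of_nodup hd
  have cG := @SimpleGraph.Subgraph.adj_comm _ _ G
  have cH := @SimpleGraph.Subgraph.adj_comm _ _ H
  unfold TwoEdges at *
  grind

theorem IsF6.adj (h : IsF6 G u v a b c) (hT : SameTriples G H) : H.Adj u v := by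
  obtain ⟨hd, he, hne⟩ := h
  have key := hT.all_of_nodup hd
  have cG := @SimpleGraph.Subgraph.adj_comm _ _ G
  have cH := @SimpleGraph.Subgraph.adj_comm _ _ H
  unfold TwoEdges at *
  grind

theorem InFamilyOriented.adj (h : InFamilyOriented G u v) (hT : SameTriples G H) : H.Adj u v := by
  rcases h with ⟨a, b, h⟩ | ⟨a, b, h⟩ | ⟨a, b, c, h⟩ | ⟨a, b, c, h⟩ | ⟨a, b, c, h⟩ | ⟨a, b, c, h⟩
  exacts [h.adj hT, h.adj hT, h.adj hT, h.adj hT, h.adj hT, h.adj hT]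

theorem EdgeInFamily.adj (h : EdgeInFamily G u v) (hT : SameTriples G H) : H.Adj u v :=
  h.elim (fun h => h.adj hT) (fun h => (h.adj hT).symm)

end Forcing

/-! ### Edges in no triangle -/

theorem adj_of_no_common_neighbor_aux {G H : LabeledGraph L} (hG : G.Connected)
    (hn : 5 ≤ G.verts.ncard) (hT : SameTriples G H) {u v a : L} (huv : G.Adj u v)
    (hno : ∀ w, ¬ (G.Adj u w ∧ G.Adj v w)) (hva : G.Adj v a) (hau : a ≠ u) : H.Adj u v := by
  by_contra hcon
  have hne : ∀ x y, G.Adj x y → x ≠ y := fun _ _ h => h.ne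
  have c := @SimpleGraph.Subgraph.adj_comm _ _ G
  have hcon' : ¬ H.Adj v u := fun h => hcon h.symm
  have f1 := fun a b (h : IsF1 G u v a b) => hcon (h.adj hT)
  have f2 := fun a b (h : IsF2 G u v a b) => hcon (h.adj hT)
  have f2' := fun a b (h : IsF2 G v u a b) => hcon' (h.adj hT)
  have f4 := fun a b c (h : IsF4 G u v a b c) => hcon (h.adj hT)
  have f5' := fun a b c (h : IsF5 G v u a b c) => hcon' (h.adj hT)
  have f6 := fun a b c (h : IsF6 G u v a b c) => hcon (h.adj hT)
  have f6' := fun a b c (h : IsF6 G v u a b c) => hcon' (h.adj hT)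
  simp only [IsF1, IsF2, IsF4, IsF5, IsF6, List.nodup_cons, List.mem_cons, List.not_mem_nil,
    or_false, not_or, List.nodup_nil, and_true, not_false_eq_true] at f1 f2 f2' f4 f5' f6 f6'
  by_cases hb : ∃ b, b ≠ v ∧ G.Adj u b
  · obtain ⟨b, hbv, hub⟩ := hb
    have hab : G.Adj a b := by
      have := f1 b a
      grind
    -- Now `u v a b` is an induced 4-cycle, whose triples are those of the complete graph; a fifth
    -- vertex is needed to force `uv`.
    obtain ⟨p, hp, x, hx, hpx⟩ := exists_adj_leaving hG (l := [u, v, a, b]) huv.fst_mem (by simp)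
      (by simp; omega)
    simp only [List.mem_cons, List.not_mem_nil, or_false, not_or] at hp hx
    have hux : ¬ G.Adj u x := by
      have := f2' b x
      grind
    have hvx : ¬ G.Adj v x := by
      have := f2 a x
      grind
    have := f6 b x a
    have := f6' a x b
    grind
  · have hvx : ∀ x, x ≠ a → x ≠ u → ¬ G.Adj v x := by
      intro x
      have := f2 a x
      grind
    obtain ⟨p, hp, x, hx, hpx⟩ := exists_adj_leaving hG (l := [u, v, a]) huv.fst_mem (by simp)
      (by simp; omega)
    simp only [List.mem_cons, List.not_mem_nil, or_false, not_or] at hp hx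
    -- The path `u v a x` alone does not force `uv`: exchanging `v` and `a` keeps its triples. A
    -- further vertex `y` attaches to `a` (fourth family) or only to `x` (fifth).
    obtain ⟨q, hq, y, hy, hqy⟩ := exists_adj_leaving hG (l := [u, v, a, x]) huv.fst_mem (by simp)
      (by simp; omega)
    simp only [List.mem_cons, List.not_mem_nil, or_false, not_or] at hq hy
    have hax : G.Adj a x := by grind
    have hay : ¬ G.Adj a y := by
      have := f4 a x y
      grind
    have := f5' y x a
    grind

theorem adj_of_no_common_neighbor {G H : LabeledGraph L} (hG : G.Connected)
    (hn : 5 ≤ G.verts.ncard) (hT : SameTriples G H) {u v : L} (huv : G.Adj u v)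
    (hno : ∀ w, ¬ (G.Adj u w ∧ G.Adj v w)) : H.Adj u v := by
  obtain ⟨p, hp, a, ha, hpa⟩ := exists_adj_leaving hG (l := [u, v]) huv.fst_mem (by simp)
    (by simp; omega)
  simp only [List.mem_cons, List.not_mem_nil, or_false, not_or] at hp ha
  rcases hp with rfl | rfl
  · exact (adj_of_no_common_neighbor_aux hG hn hT huv.symm (fun w h => hno w h.symm) hpa ha.2).symm
  · exact adj_of_no_common_neighbor_aux hG hn hT huv hno hpa ha.1

/-! ### Twins, and sufficiency of the conditions -/

/-- Two distinct vertices with the same neighbors outside the pair. -/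
def Twins (G : LabeledGraph L) (x y : L) : Prop :=
  x ≠ y ∧ ∀ z, z ≠ x → z ≠ y → (G.Adj x z ↔ G.Adj y z)

theorem neighborSet_diff_eq_iff_twins {G : LabeledGraph L} {x y : L} (hxy : x ≠ y) :
    G.neighborSet x \ {y} = G.neighborSet y \ {x} ↔ Twins G x y := by
  have hx : ¬ G.Adj x x := fun h => h.ne rfl
  have hy : ¬ G.Adj y y := fun h => h.ne rfl
  simp only [Set.ext_iff, Set.mem_sdiff, Set.mem_singleton_iff, SimpleGraph.Subgraph.mem_neighborSet]
  constructor
  · intro h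
    exact ⟨hxy, fun z hz1 hz2 => by simpa [hz1, hz2] using h z⟩
  · rintro ⟨-, h⟩ z
    have := h z
    grind

theorem stronglyT3Reconstructible_of_edges {G : LabeledGraph L} (hG : G.Connected)
    (hn : 5 ≤ G.verts.ncard) (htw : ∀ x ∈ G.verts, ∀ y ∈ G.verts, ¬ Twins G x y)
    (hfam : ∀ u v : L, EdgeInTriangle G u v → EdgeInFamily G u v) :
    StronglyT3Reconstructible G := by
  intro H hHfin hH hT
  have hverts := verts_eq_of_connectedTriples_eq hHfin hG hH (by omega) hT
  rw [connectedTriples_eq_iff] at hT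
  have hle : ∀ u v, G.Adj u v → H.Adj u v := by
    intro u v huv
    by_cases h : ∃ w, G.Adj u w ∧ G.Adj v w
    · exact (hfam u v ⟨huv, h⟩).adj hT
    · exact adj_of_no_common_neighbor hG hn hT huv (not_exists.1 h)
  refine SimpleGraph.Subgraph.ext hverts ?_
  ext u v
  refine ⟨fun huv => ?_, hle u v⟩
  by_contra hcon
  -- If `z` is a `G`-neighbor of `u` or `v`, then `uvz` is connected in `H`, hence in `G`, where
  -- without `uv` both other edges are required.
  refine htw u (hverts ▸ huv.fst_mem) v (hverts ▸ huv.snd_mem) ⟨huv.ne, fun z hzu hzv => ?_⟩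
  have h1 := hT u v z huv.ne hzu.symm hzv.symm
  have h2 := hle u z
  have h3 := hle v z
  unfold TwoEdges at h1
  tauto

/-! ### Necessity: modifications that preserve the triples -/

/-- A `G`-edge across a cut extends to a connected triple, and the two `H`-edges of that triple
cannot both avoid the cut. -/
theorem SameTriples.connected {G H : LabeledGraph L} (hT : SameTriples G H) (hG : G.Connected)
    (hn : 3 ≤ G.verts.ncard) (hverts : H.verts = G.verts) : H.Connected := by
  obtain ⟨v, hv⟩ := hG.nonempty
  refine connected_of_adj_boundary (hverts ▸ hv) ?_
  rintro S hvS ⟨z, hz, hzS⟩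
  obtain ⟨p, hp, q, hq, hpq⟩ := exists_adj_boundary hG S hv (hverts ▸ hz) hvS hzS
  obtain ⟨s, hs, r, hr, hsr⟩ := exists_adj_leaving hG (l := [p, q]) hpq.fst_mem (by simp)
    (by simp; omega)
  simp only [List.mem_cons, List.not_mem_nil, or_false, not_or] at hs hr
  have c := @SimpleGraph.Subgraph.adj_comm _ _ G
  have c' := @SimpleGraph.Subgraph.adj_comm _ _ H
  have h := hT p q r hpq.ne (Ne.symm hr.1) (Ne.symm hr.2)
  unfold TwoEdges at h
  by_contra! hcon
  have h1 := hcon p hp q hq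
  have h2 := hcon p hp r
  have h3 := hcon r
  grind

/-- A strongly reconstructible graph is determined among all graphs on its vertex set, connected
or not, by its triples. -/
theorem StronglyT3Reconstructible.eq_of_sameTriples {G H : LabeledGraph L}
    (h : StronglyT3Reconstructible G) (hfin : G.verts.Finite) (hG : G.Connected)
    (hn : 3 ≤ G.verts.ncard) (hverts : H.verts = G.verts) (hT : SameTriples G H) : H = G :=
  h H (hverts ▸ hfin) (hT.connected hG hn hverts) ((connectedTriples_eq_iff G H).2 hT)

/-- `G` with the pair `x, y` switched between edge and non-edge. -/
def toggle (G : LabeledGraph L) {x y : L} (hx : x ∈ G.verts) (hy : y ∈ G.verts) (hxy : x ≠ y) :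
    LabeledGraph L where
  verts := G.verts
  Adj p q := ((p = x ∧ q = y ∨ p = y ∧ q = x) ∧ ¬ G.Adj x y) ∨
    (¬ (p = x ∧ q = y ∨ p = y ∧ q = x) ∧ G.Adj p q)
  adj_sub := by
    rintro p q (⟨⟨rfl, rfl⟩ | ⟨rfl, rfl⟩, -⟩ | ⟨-, h⟩)
    exacts [hxy, hxy.symm, h.ne]
  edge_vert := by
    rintro p q (⟨⟨rfl, rfl⟩ | ⟨rfl, rfl⟩, -⟩ | ⟨-, h⟩)
    exacts [hx, hy, h.fst_mem]
  symm := by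
    refine ⟨fun p q h => ?_⟩
    have := G.adj_comm p q
    tauto

theorem StronglyT3Reconstructible.not_twins {G : LabeledGraph L}
    (h : StronglyT3Reconstructible G) (hfin : G.verts.Finite) (hG : G.Connected)
    (hn : 3 ≤ G.verts.ncard) {x y : L} (hx : x ∈ G.verts) (hy : y ∈ G.verts) : ¬ Twins G x y := by
  rintro ⟨hxy, htw⟩
  have heq := h.eq_of_sameTriples (H := G.toggle hx hy hxy) hfin hG hn rfl ?_
  · have : (G.toggle hx hy hxy).Adj x y ↔ G.Adj x y := by rw [heq]
    simp [toggle] at this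
  -- A third vertex sees both twins or neither, so the switched pair never decides whether there are
  -- two edges.
  · intro p q r hpq hpr hqr
    have c := @SimpleGraph.Subgraph.adj_comm _ _ G
    simp only [TwoEdges, toggle]
    grind

/-- `G` with the labels `x` and `y` exchanged. -/
def swapLabels [DecidableEq L] (G : LabeledGraph L) {x y : L} (hx : x ∈ G.verts)
    (hy : y ∈ G.verts) : LabeledGraph L where
  verts := G.verts
  Adj p q := G.Adj (Equiv.swap x y p) (Equiv.swap x y q)
  adj_sub := by
    rintro p q h rfl
    exact h.ne rfl
  edge_vert := by
    intro p q h
    have := h.fst_mem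
    grind
  symm := ⟨fun _ _ h => SimpleGraph.Subgraph.Adj.symm h⟩

/-- If the vertices of a path `v u a x` have, apart from its edges, the same neighbors, then
exchanging the labels `u` and `a` preserves the connected triples. -/
theorem sameTriples_swapLabels [DecidableEq L] {G : LabeledGraph L} {v u a x : L}
    (hu : u ∈ G.verts) (ha : a ∈ G.verts) {C : L → Prop}
    (hNv : ∀ y, G.Adj v y ↔ C y ∨ y = u) (hNu : ∀ y, G.Adj u y ↔ C y ∨ y = v ∨ y = a)
    (hNa : ∀ y, G.Adj a y ↔ C y ∨ y = u ∨ y = x) (hNx : ∀ y, G.Adj x y ↔ C y ∨ y = a) :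
    SameTriples G (G.swapLabels hu ha) := by
  have c := @SimpleGraph.Subgraph.adj_comm _ _ G
  intro p q r hpq hpr hqr
  simp only [TwoEdges, swapLabels, Equiv.swap_apply_def]
  grind

theorem StronglyT3Reconstructible.edgeInFamily_aux {G : LabeledGraph L}
    (h : StronglyT3Reconstructible G) (hfin : G.verts.Finite) (hG : G.Connected)
    (hn : 3 ≤ G.verts.ncard) {u v a : L} (huv : G.Adj u v) (hua : G.Adj u a) (hva : ¬ G.Adj v a)
    (hav : a ≠ v) : EdgeInFamily G u v := by
  classical
  by_contra hcon
  have hne : ∀ x y, G.Adj x y → x ≠ y := fun _ _ h => h.ne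
  have c := @SimpleGraph.Subgraph.adj_comm _ _ G
  have htw := fun x y hx hy => h.not_twins hfin hG hn (x := x) (y := y) hx hy
  simp only [EdgeInFamily, InFamilyOriented, not_or, not_exists] at hcon
  obtain ⟨⟨f1, f2, f3, f4, f5, f6⟩, f1', f2', f3', f4', f5', f6'⟩ := hcon
  simp only [IsF1, IsF2, IsF3, IsF4, IsF5, IsF6, List.nodup_cons, List.mem_cons, List.not_mem_nil,
    or_false, not_or, List.nodup_nil, and_true, not_false_eq_true]
    at f1 f2 f3 f4 f5 f6 f1' f2' f3' f4' f5' f6'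
  have hA : ∀ y, G.Adj u y → ¬ G.Adj v y → y = v ∨ y = a := by
    intro y
    have := f2' a y
    grind
  have haN : ∀ y, G.Adj v y → y ≠ u → G.Adj a y := by
    intro y
    have := f1 a y
    grind
  have hB : ∀ b, G.Adj v b → b ≠ u → G.Adj u b := by
    intro b hvb hbu
    by_contra hub
    have hab := haN b hvb hbu
    refine htw u b huv.fst_mem hvb.snd_mem ⟨hbu.symm, fun z hzu hzb => ?_⟩
    have h1 := f2 b z
    have h2 := f1' b z
    have h3 := f6' b z a
    have h4 := hA z
    grind
  -- Such an `x` exists because `a` and `v` are not twins.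
  obtain ⟨x, hax, hvx, hxv, hxa⟩ : ∃ x, G.Adj a x ∧ ¬ G.Adj v x ∧ x ≠ v ∧ x ≠ a := by
    by_contra! hcon
    refine htw a v hua.snd_mem huv.snd_mem ⟨hav, fun z hza hzv => ?_⟩
    have h1 := hcon z
    have h2 := haN z
    grind
  have hxu : x ≠ u := by
    rintro rfl
    exact hvx huv.symm
  have hux : ¬ G.Adj u x := fun h => by
    have := hA x h hvx
    tauto
  have hNx : ∀ y, G.Adj v y → y ≠ u → G.Adj x y := by
    intro y
    have := f3 x a y
    have := haN y
    have := hB y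
    grind
  have hxN : ∀ y, G.Adj x y → y ≠ a → G.Adj a y := by
    intro y
    have := f5 y x a
    grind
  have haX : ∀ y, G.Adj a y → ¬ G.Adj v y → y = u ∨ y = x := by
    intro y
    have := f4' a x y
    have := hA y
    grind
  -- The excluded families leave the neighbors of `v` other than `u` as the common neighbors of all
  -- four path vertices, and no others off the path.
  have hT := sameTriples_swapLabels (v := v) (x := x) (C := fun y => G.Adj v y ∧ y ≠ u)
    huv.fst_mem hua.snd_mem (by grind) (by grind) (by grind) (by grind)
  have heq := h.eq_of_sameTriples (H := G.swapLabels huv.fst_mem hua.snd_mem) hfin hG hn rfl hT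
  have hadj : (G.swapLabels huv.fst_mem hua.snd_mem).Adj v a ↔ G.Adj v a := by rw [heq]
  refine hva (hadj.1 ?_)
  simpa [swapLabels, Equiv.swap_apply_def, huv.ne.symm, hav.symm, hua.ne.symm] using huv.symm

theorem StronglyT3Reconstructible.edgeInFamily {G : LabeledGraph L}
    (h : StronglyT3Reconstructible G) (hfin : G.verts.Finite) (hG : G.Connected)
    (hn : 3 ≤ G.verts.ncard) {u v : L} (huv : G.Adj u v) : EdgeInFamily G u v := by
  by_cases hu : ∃ a, G.Adj u a ∧ ¬ G.Adj v a ∧ a ≠ v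
  · obtain ⟨a, hua, hva, hav⟩ := hu
    exact h.edgeInFamily_aux hfin hG hn huv hua hva hav
  by_cases hv : ∃ a, G.Adj v a ∧ ¬ G.Adj u a ∧ a ≠ u
  · obtain ⟨a, hva, hua, hau⟩ := hv
    exact (h.edgeInFamily_aux hfin hG hn huv.symm hva hua hau).symm
  · refine (h.not_twins hfin hG hn huv.fst_mem huv.snd_mem ⟨huv.ne, fun z hzu hzv => ?_⟩).elim
    push Not at hu hv
    have := hu z
    have := hv z
    tauto

end LabeledGraph

theorem theorem4p12 {L : Type*} (G : LabeledGraph L) (hfin : G.verts.Finite)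
    (hconn : G.Connected) (hn : 5 ≤ G.verts.ncard) :
    LabeledGraph.StronglyT3Reconstructible G ↔
      ((∀ v₁ ∈ G.verts, ∀ v₂ ∈ G.verts, v₁ ≠ v₂ →
          G.neighborSet v₁ \ {v₂} ≠ G.neighborSet v₂ \ {v₁}) ∧
        (∀ u v : L, LabeledGraph.EdgeInTriangle G u v → LabeledGraph.EdgeInFamily G u v)) := by
  constructor
  · intro h
    refine ⟨fun x hx y hy hxy heq => ?_, fun u v huv => h.edgeInFamily hfin hconn (by omega) huv.1⟩
    exact h.not_twins hfin hconn (by omega) hx hy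
      ((LabeledGraph.neighborSet_diff_eq_iff_twins hxy).1 heq)
  · rintro ⟨htw, hfam⟩
    refine LabeledGraph.stronglyT3Reconstructible_of_edges hconn hn (fun x hx y hy h => ?_) hfam
    exact htw x hx y hy h.1 ((LabeledGraph.neighborSet_diff_eq_iff_twins h.1).2 h)
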